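/- Simplicial complexes may have any dimension and are not assumed locally finite; geometric realizations carry the weak topology. A simplicial map is called non-degenerate if it is injective on every simplex. A simplicial complex $Z$ is called geometrically simply connected (gsc) if it can be written as $$Z=T\ \cup\ \{\text{1-cells } H^1_i\}_{i\in I}\ \cup\ \{\text{2-cells } H^2_j\}_{j\in I}\ \cup\ \{\text{remaining cells of dimension}\ge 2\},$$ where $T$ is a tree in the 1-skeleton containing all vertices of $Z$, the $H^1_i$ are the edges of $Z$ not in $T$, the $H^2_j$ are pairwise distinct 2-simplices indexed by the same set $I$, and, writing $H^2_j\cdot H^1_i\in\mathbb Z_{\ge 0}$ for the number of times $\partial H^2_j$ runs through $H^1_i$, $$H^2_j\cdot H^1_i=\delta_{ji}+a_{ji},\qquad a_{ji}\in\mathbb Z_{\ge 0},\qquad a_{ji}>0\ \Rightarrow\ r(i)<r(j)$$ for some function $r:I\to\mathbb N$, which is injective if $I$ is countable (so that $I$ is then enumerated by natural numbers and $a_{ji}>0$ implies $j>i$). **Proposition.** Let $G$ be a discrete group and let $X$ be a simply connected simplicial complex, with a simplicial action of $G$ that is free on the geometric realization of $X$. Assume that the link of every vertex of $X$ is connected and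 is not a single point (so every edge of $X$ lies in a 2-simplex, and $X$ has no local cut points). Let $Y$ be a simplicial complex and $F:Y\to X$ a non-degenerate simplicial map such that $F:Y^{(0)}\to X^{(0)}$ is surjective with countable fibers. Then there exist a simplicial complex $Z$ containing $Y$ as a subcomplex and a map $F_1:Z\to X$ with $F_1|_Y=F$ such that 1. $F_1$ is simplicial and non-degenerate; 2. $Z$ is geometrically simply connected; 3. there is a simplicial action of $G$ on $Z$, free on the geometric realization of $Z$, for which $F_1$ is equivariant: $F_1(gz)=g\,F_1(z)$ for all $g\in G$, $z\in Z$. -/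

import Mathlib

universe u v w

namespace AbstractSimplicialComplex

/-- The points of the geometric realization `|K|`, in barycentric coordinates: finitely supported
nonnegative weights of total mass one on the vertices whose support is a simplex of `K`. -/
def Realization {V : Type u} (K : AbstractSimplicialComplex V) : Type u :=
  {p : V →₀ ℝ // p.support ∈ K.faces ∧ (∀ x, 0 ≤ p x) ∧ (p.sum fun _ t => t) = 1}

/-- The characteristic map of the closed simplex spanned by a face `s` of `K`. -/
noncomputable def ofSimplex {V : Type u} (K : AbstractSimplicialComplex V) (s : K.faces)
    (p : stdSimplex ℝ {x // x ∈ s.1}) : K.Realization :=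
  ⟨(Finsupp.equivFunOnFinite.symm p.1).embDomain (Function.Embedding.subtype _), by
    have hsum : ((Finsupp.equivFunOnFinite.symm p.1).embDomain
        (Function.Embedding.subtype (· ∈ s.1))).sum (fun _ t => t) = 1 := by
      rw [Finsupp.sum_embDomain, Finsupp.sum_fintype _ _ (fun _ => rfl)]
      exact p.2.2
    refine ⟨?_, ?_, hsum⟩
    · refine (K.isRelLowerSet_faces s.2).2 ?_ ?_
      · intro x hx
        rw [Finsupp.support_embDomain, Finset.mem_map] at hx
        obtain ⟨y, -, rfl⟩ := hx
        exact y.2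
      · rw [Finsupp.support_nonempty_iff]
        intro h
        rw [h] at hsum
        simp at hsum
    · intro x
      by_cases hx : x ∈ s.1
      · have h := Finsupp.embDomain_apply_self (Function.Embedding.subtype (· ∈ s.1))
          (Finsupp.equivFunOnFinite.symm p.1) ⟨x, hx⟩
        exact le_of_le_of_eq (p.2.1 ⟨x, hx⟩) h.symm
      · rw [Finsupp.embDomain_of_notMem_range]
        rintro ⟨y, rfl⟩
        exact hx y.2⟩

/-- The weak topology: a set is open if and only if its trace on every closed simplex is open. -/
noncomputable instance {V : Type u} (K : AbstractSimplicialComplex V) : TopologicalSpace K.Realization :=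
  ⨆ s : K.faces, TopologicalSpace.coinduced (K.ofSimplex s) inferInstance

open Classical in
/-- `f` is (the vertex map of) a simplicial map `K → L` which is non-degenerate, that is,
injective on every simplex. -/
def IsNondegenerateMap {V : Type u} {W : Type v} (K : AbstractSimplicialComplex V)
    (L : AbstractSimplicialComplex W) (f : V → W) : Prop :=
  ∀ s ∈ K.faces, s.image f ∈ L.faces ∧ Set.InjOn f (s : Set V)

open Classical in
/-- `f` is (the vertex map of) an isomorphism from `K` onto a subcomplex of `L`. -/
def IsInclusion {V : Type u} {W : Type v} (K : AbstractSimplicialComplex V)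
    (L : AbstractSimplicialComplex W) (f : V → W) : Prop :=
  Function.Injective f ∧ ∀ s ∈ K.faces, s.image f ∈ L.faces

open Classical in
/-- The action of `G` on the vertices is an action on `K` by simplicial automorphisms, and the
induced action on the geometric realization (which moves barycentric coordinates along
`x ↦ g • x`) is free. -/
def IsFreeAction (G : Type w) [Group G] {V : Type u} [MulAction G V]
    (K : AbstractSimplicialComplex V) : Prop :=
  (∀ g : G, ∀ s ∈ K.faces, s.image (g • ·) ∈ K.faces) ∧
  ∀ (g : G) (p : K.Realization), p.1.mapDomain (g • ·) = p.1 → g = 1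

open Classical in
/-- The 1-skeleton of `K`. -/
def oneSkeleton {V : Type u} (K : AbstractSimplicialComplex V) : SimpleGraph V where
  Adj x y := x ≠ y ∧ {x, y} ∈ K.faces
  symm := ⟨fun x y h => ⟨h.1.symm, by rw [Finset.pair_comm]; exact h.2⟩⟩
  loopless := ⟨fun _ h => h.1 rfl⟩

open Classical in
/-- The 1-skeleton of the link of the vertex `x`. -/
def linkGraph {V : Type u} (K : AbstractSimplicialComplex V) (x : V) :
    SimpleGraph {y // K.oneSkeleton.Adj x y} where
  Adj y z := y ≠ z ∧ {x, y.1, z.1} ∈ K.faces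
  symm := ⟨fun y z h => ⟨h.1.symm, by rw [Finset.pair_comm]; exact h.2⟩⟩
  loopless := ⟨fun _ h => h.1 rfl⟩

/-- The link of every vertex is connected (in particular nonempty) and is not a single point. -/
def HasConnectedLinks {V : Type u} (K : AbstractSimplicialComplex V) : Prop :=
  ∀ x : V, Nontrivial {y // K.oneSkeleton.Adj x y} ∧ (K.linkGraph x).Connected

open Classical in
/-- The number of times that the boundary of the 2-simplex with vertex set `t` runs through the
edge `e`. -/
noncomputable def intersectionNumber {V : Type u} (t : Finset V) (e : Sym2 V) : ℕ :=
  if ∀ x ∈ e, x ∈ t then 1 else 0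

/-- `K` is geometrically simply connected with respect to its own cell structure:
`K = T ∪ {1-cells} ∪ {2-cells H j} ∪ {remaining cells of dimension ≥ 2}`, where `T` is a tree
containing all vertices (a subcomplex, hence closed in `|K|` and properly embedded), the 1-cells
are the edges `i` outside `T`, the `H j` are 2-simplices in bijection with these edges, and the
geometric intersection matrix `H j · i` is of the form `δ j i + a j i` with `a j i > 0` only for
`j > i`. The order is the one given by `rank`; for countably many 1-cells it is an enumeration of
them by natural numbers. -/
def IsGSC {V : Type u} (K : AbstractSimplicialComplex V) : Prop :=
  ∃ T : SimpleGraph V, T ≤ K.oneSkeleton ∧ T.IsTree ∧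
    ∃ (H : {e : Sym2 V // e ∈ K.oneSkeleton.edgeSet \ T.edgeSet} →
        {t : Finset V // t ∈ K.faces ∧ t.card = 3})
      (rank : {e : Sym2 V // e ∈ K.oneSkeleton.edgeSet \ T.edgeSet} → ℕ),
      Function.Injective H ∧
      (Countable {e : Sym2 V // e ∈ K.oneSkeleton.edgeSet \ T.edgeSet} →
        Function.Injective rank) ∧
      ∃ a : {e : Sym2 V // e ∈ K.oneSkeleton.edgeSet \ T.edgeSet} →
          {e : Sym2 V // e ∈ K.oneSkeleton.edgeSet \ T.edgeSet} → ℕ,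
        (∀ i, intersectionNumber (H i).1 i.1 = 1 + a i i) ∧
        (∀ j i, j ≠ i → intersectionNumber (H j).1 i.1 = a j i) ∧
        ∀ j i, 0 < a j i → rank i < rank j

end AbstractSimplicialComplex

/-! Let `Z` be the largest complex on the vertex set `V × List V` for which the projection to `X` is
simplicial and non-degenerate. Everything except geometric simple connectivity is then formal: `G`
acts on the first coordinate, freeness is inherited from `X`, and `Y` embeds because each fibre of
`F` is countable while `List V` is infinite.

For geometric simple connectivity, `exists_locallySurjective_tree` gives a spanning tree in which
every vertex of `Z` has a neighbour over each neighbour of its image. Close the tree under adding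
the third side of a 2-simplex with two sides already present. If this yields every edge, each edge
outside the tree is paired with a 2-simplex that first produces it, whose other sides appear at
earlier stages; this is `isGSC_of_triangleClosure_eq`.

That every edge does arise is `eq_pullback_oneSkeleton`. In the closed graph, call two vertices of
one fibre twins if they have the same neighbours. Connectedness of links shows that a single common
neighbour already makes them twins (`twin_of_common_neighbor`), so edges of `X` lift uniquely to
twin classes, and closure under triangles makes these lifts compatible around 2-simplices. The twin
classes thus form a covering of `X`, connected because the tree is. As `X` is simply connected,
there is one class over each vertex, and local surjectivity then gives every edge. -/

/-! ### Permutation cocycles on simply connected spaces -/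

open Bundle in
/-- A locally constant cocycle of permutations, defined with respect to an open cover of a simply
connected space, is trivial. -/
theorem exists_trivialization_of_cocycle {B : Type u} [TopologicalSpace B] [SimplyConnectedSpace B]
    {ι : Type v} {D : Type w} (U : ι → Set B) (hU : ∀ i, IsOpen (U i)) (hcov : ∀ b, ∃ i, b ∈ U i)
    (c : ι → ι → D → D) (hself : ∀ i d, c i i d = d)
    (hcomp : ∀ i j k, (U i ∩ U j ∩ U k).Nonempty → ∀ d, c j k (c i j d) = c i k d) :
    ∃ (E : Type w) (h : B → ι → D → E),
      (∀ b i, b ∈ U i → Function.Injective (h b i)) ∧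
      (∀ b i j, b ∈ U i → b ∈ U j → ∀ d, h b j (c i j d) = h b i d) ∧
      ∀ a b i, JoinedIn (U i) a b → h a i = h b i := by
  classical
  let _ : TopologicalSpace D := ⊥
  have : DiscreteTopology D := ⟨rfl⟩
  choose idx hidx using hcov
  let Z : FiberBundleCore ι B D :=
    { baseSet := U
      isOpen_baseSet := hU
      indexAt := idx
      mem_baseSet_at := hidx
      coordChange := fun i j _ d => c i j d
      coordChange_self := fun i _ _ d => hself i d
      continuousOn_coordChange := fun i j =>
        ((continuous_of_discreteTopology (f := c i j)).comp continuous_snd).continuousOn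
      coordChange_comp := fun i j k x hx d => hcomp i j k ⟨x, hx⟩ d }
  have cov : IsCoveringMap (π D Z.Fiber) := FiberBundle.isCoveringMap
  obtain ⟨b₀⟩ : Nonempty B := inferInstance
  -- Labels are obtained by transporting each fibre to the one over `b₀`; simple connectivity makes
  -- the choice of path irrelevant.
  let γ (b : B) : Path.Homotopic.Quotient b b₀ := .mk (PathConnectedSpace.somePath b b₀)
  have huniq {a b : B} (p q : Path.Homotopic.Quotient a b) : p = q := Subsingleton.elim _ _
  let pt (b : B) (i : ι) (d : D) : (π D Z.Fiber) ⁻¹' {b} := ⟨⟨b, c i (idx b) d⟩, rfl⟩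
  let val (e : (π D Z.Fiber) ⁻¹' {b₀}) : D := e.1.2
  have hval : Function.Injective val := by
    rintro ⟨⟨b, d⟩, hb⟩ ⟨⟨b', d'⟩, hb'⟩ h
    obtain rfl : b = b₀ := hb
    obtain rfl : b' = b := hb'
    obtain rfl : d = d' := h
    rfl
  refine ⟨D, fun b i d => val (cov.monodromy (γ b) (pt b i d)), ?_, ?_, ?_⟩
  · intro b i hb d d' h
    have h1 := (cov.monodromy_bijective (γ b)).1 (hval h)
    have h2 : c i (idx b) d = c i (idx b) d' :=
      congrArg (fun e : (π D Z.Fiber) ⁻¹' {b} => (show D from e.1.2)) h1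
    have h3 := congrArg (c (idx b) i) h2
    rwa [hcomp _ _ _ ⟨b, ⟨hb, hidx b⟩, hb⟩, hcomp _ _ _ ⟨b, ⟨hb, hidx b⟩, hb⟩, hself, hself] at h3
  · intro b i j hi hj d
    have : pt b j (c i j d) = pt b i d := by
      apply Subtype.ext
      simp only [pt]
      rw [hcomp _ _ _ ⟨b, ⟨hi, hj⟩, hidx b⟩]
    simp only [this]
  · intro a b i hab
    funext d
    -- Inside one chart, the lift of a path is the section with constant coordinate `d`.
    have key : cov.monodromy (.mk hab.somePath) (pt a i d) = pt b i d := by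
      have hcont : Continuous fun t => (Z.localTriv i).toOpenPartialHomeomorph.symm
          (hab.somePath t, d) := by
        refine (Z.localTriv i).toOpenPartialHomeomorph.symm.continuousOn.comp_continuous
          (by fun_prop) fun t => ?_
        rw [OpenPartialHomeomorph.symm_source]
        exact (Z.mem_localTriv_target _ _).2 (hab.somePath_mem t)
      have := (cov.eq_liftPath_iff (γ := (hab.somePath : C(unitInterval, B)))
        (e := (pt a i d).1) (γ_0 := by simp [pt]) (Γ := fun t =>
          (Z.localTriv i).toOpenPartialHomeomorph.symm (hab.somePath t, d))).2
          ⟨hcont, by ext t; rfl, by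
            change (⟨hab.somePath 0, c i (idx (hab.somePath 0)) d⟩ : TotalSpace D Z.Fiber) = _
            rw [hab.somePath.source]⟩
      apply Subtype.ext
      have h1 := congrFun this 1
      refine h1.symm.trans ?_
      change (⟨hab.somePath 1, c i (idx (hab.somePath 1)) d⟩ : TotalSpace D Z.Fiber) = _
      rw [hab.somePath.target]
    change val _ = val _
    rw [← key, ← cov.monodromy_trans_apply, huniq ((Path.Homotopic.Quotient.mk _).trans _) (γ a)]

/-! ### Open stars, and the passage from the realization to the 1-skeleton -/

namespace AbstractSimplicialComplex

variable {V : Type u} (K : AbstractSimplicialComplex V)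

open Classical in
theorem ofSimplex_apply (s : K.faces) (p : stdSimplex ℝ {x // x ∈ s.1}) (x : V) :
    (K.ofSimplex s p).1 x = if h : x ∈ s.1 then p.1 ⟨x, h⟩ else 0 := by
  unfold ofSimplex
  split_ifs with h
  · exact Finsupp.embDomain_apply_self (Function.Embedding.subtype (· ∈ s.1))
      (Finsupp.equivFunOnFinite.symm p.1) ⟨x, h⟩
  · refine Finsupp.embDomain_of_notMem_range _ _ _ ?_
    rintro ⟨y, rfl⟩
    exact h y.2

theorem Realization.ext {p q : K.Realization} (h : ∀ x, p.1 x = q.1 x) : p = q :=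
  Subtype.ext (Finsupp.ext h)

theorem continuous_ofSimplex (s : K.faces) : Continuous (K.ofSimplex s) :=
  continuous_iff_coinduced_le.2 (le_iSup (fun s : K.faces =>
    TopologicalSpace.coinduced (K.ofSimplex s) inferInstance) s)

theorem isOpen_realization_iff {A : Set K.Realization} :
    IsOpen A ↔ ∀ s, IsOpen (K.ofSimplex s ⁻¹' A) := by
  change @IsOpen _ (⨆ s : K.faces, TopologicalSpace.coinduced (K.ofSimplex s) inferInstance) A ↔ _
  simp only [isOpen_iSup_iff, isOpen_coinduced]

/-- The open star of a vertex. -/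
def openStar (x : V) : Set K.Realization := {p | 0 < p.1 x}

theorem mem_openStar_iff {x : V} {p : K.Realization} : p ∈ K.openStar x ↔ x ∈ p.1.support := by
  rw [Finsupp.mem_support_iff]
  exact (p.2.2.1 x).lt_iff_ne'

theorem isOpen_openStar (x : V) : IsOpen (K.openStar x) := by
  classical
  rw [isOpen_realization_iff]
  intro s
  by_cases h : x ∈ s.1
  · have : K.ofSimplex s ⁻¹' K.openStar x = {p | 0 < p.1 ⟨x, h⟩} := by
      ext p
      simp [openStar, ofSimplex_apply, h]
    rw [this]
    exact isOpen_lt continuous_const ((continuous_apply _).comp continuous_subtype_val)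
  · have : K.ofSimplex s ⁻¹' K.openStar x = ∅ := by
      ext p
      simp [openStar, ofSimplex_apply, h]
    rw [this]
    exact isOpen_empty

theorem exists_mem_openStar (p : K.Realization) : ∃ x, p ∈ K.openStar x := by
  obtain ⟨x, hx⟩ := (K.isRelLowerSet_faces p.2.1).1
  exact ⟨x, K.mem_openStar_iff.2 hx⟩

variable {K}

theorem mem_faces_of_mem_openStar {p : K.Realization} {s : Finset V} (hs : s.Nonempty)
    (h : ∀ x ∈ s, p ∈ K.openStar x) : s ∈ K.faces :=
  (K.isRelLowerSet_faces p.2.1).2 (fun x hx => K.mem_openStar_iff.1 (h x hx)) hs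

/-- The part of a closed simplex where the coordinate at `x` is positive is convex. -/
theorem joinedIn_openStar (s : K.faces) (x : V) (hx : x ∈ s.1)
    (p q : stdSimplex ℝ {x // x ∈ s.1}) (hp : 0 < p.1 ⟨x, hx⟩) (hq : 0 < q.1 ⟨x, hx⟩) :
    JoinedIn (K.openStar x) (K.ofSimplex s p) (K.ofSimplex s q) := by
  classical
  have hconv : Convex ℝ (stdSimplex ℝ {x // x ∈ s.1} ∩ {r | 0 < r ⟨x, hx⟩}) :=
    (convex_stdSimplex ℝ _).inter
      (convex_halfSpace_gt (f := fun r : {x // x ∈ s.1} → ℝ => r ⟨x, hx⟩)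
        ⟨fun _ _ => rfl, fun _ _ => rfl⟩ 0)
  obtain ⟨γ, hγ⟩ := (hconv.isPathConnected ⟨p.1, p.2, hp⟩).joinedIn p.1 ⟨p.2, hp⟩ q.1 ⟨q.2, hq⟩
  refine ⟨⟨⟨fun t => K.ofSimplex s ⟨γ t, (hγ t).1⟩,
    (K.continuous_ofSimplex s).comp (γ.continuous.subtype_mk _)⟩, ?_, ?_⟩, ?_⟩
  · simp
  · simp
  · intro t
    change 0 < (K.ofSimplex s ⟨γ t, (hγ t).1⟩).1 x
    rw [ofSimplex_apply, dif_pos hx]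
    exact (hγ t).2

/-- A vertex, as a point of the geometric realization. -/
noncomputable def vertexPoint (K : AbstractSimplicialComplex V) (x : V) : K.Realization :=
  ⟨Finsupp.single x 1, by
    rw [Finsupp.support_single x one_ne_zero]; exact K.singleton_mem x, by
    classical
    intro y
    rw [Finsupp.single_apply]
    split_ifs <;> simp, by simp⟩

theorem vertexPoint_mem_openStar (x : V) : K.vertexPoint x ∈ K.openStar x := by
  change 0 < (Finsupp.single x (1 : ℝ)) x
  simp

open Classical in
/-- The midpoint of an edge lies in the open stars of both endpoints, and is joined to them
there. -/
theorem exists_joinedIn_of_adj {x y : V} (h : K.oneSkeleton.Adj x y) :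
    ∃ m, JoinedIn (K.openStar x) (K.vertexPoint x) m ∧
      JoinedIn (K.openStar y) (K.vertexPoint y) m := by
  obtain ⟨hne, hf⟩ := h
  let s : K.faces := ⟨{x, y}, hf⟩
  have hx : x ∈ s.1 := by simp [s]
  have hy : y ∈ s.1 := by simp [s]
  let p (z : {z // z ∈ s.1}) : stdSimplex ℝ {x // x ∈ s.1} :=
    ⟨Pi.single z 1, single_mem_stdSimplex ℝ z⟩
  have hp (z : {z // z ∈ s.1}) : K.ofSimplex s (p z) = K.vertexPoint z.1 := by
    refine Realization.ext K fun w => ?_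
    rw [ofSimplex_apply]
    simp only [vertexPoint, p, Finsupp.single_apply, Pi.single_apply, Subtype.ext_iff]
    split_ifs with h1 h2 h3 h4 <;> first | rfl | (exfalso; subst_vars; simp_all)
  let m : stdSimplex ℝ {x // x ∈ s.1} :=
    ⟨(1 / 2 : ℝ) • (p ⟨x, hx⟩).1 + (1 / 2 : ℝ) • (p ⟨y, hy⟩).1,
      convex_stdSimplex ℝ _ (p ⟨x, hx⟩).2 (p ⟨y, hy⟩).2 (by norm_num) (by norm_num) (by norm_num)⟩
  have hm (z : {z // z ∈ s.1}) (hz : z.1 = x ∨ z.1 = y) : 0 < m.1 z := by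
    simp only [m, p, Pi.add_apply, Pi.smul_apply, smul_eq_mul, Pi.single_apply, Subtype.ext_iff]
    rcases hz with h | h
    · simp [h, hne]
    · simp [h, hne.symm]
  refine ⟨K.ofSimplex s m, ?_, ?_⟩
  · rw [← hp ⟨x, hx⟩]
    exact joinedIn_openStar s x hx _ _ (by simp [p]) (hm _ (Or.inl rfl))
  · rw [← hp ⟨y, hy⟩]
    exact joinedIn_openStar s y hy _ _ (by simp [p]) (hm _ (Or.inr rfl))

open Classical in
/-- On a simply connected complex, every cocycle of permutations is a coboundary. -/
theorem exists_coboundary [SimplyConnectedSpace K.Realization] {D : Type w} (c : V → V → D → D)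
    (hself : ∀ x d, c x x d = d)
    (hcomp : ∀ x y z, {x, y, z} ∈ K.faces → ∀ d, c y z (c x y d) = c x z d) :
    ∃ (E : Type w) (h : V → D → E), (∀ x, Function.Injective (h x)) ∧
      ∀ x y, K.oneSkeleton.Adj x y → ∀ d, h y (c x y d) = h x d := by
  obtain ⟨E, h, hinj, hc, hj⟩ := exists_trivialization_of_cocycle K.openStar K.isOpen_openStar
    K.exists_mem_openStar c hself fun x y z ⟨p, ⟨hx, hy⟩, hz⟩ => hcomp x y z
      (mem_faces_of_mem_openStar (p := p) (by simp) (by simp [hx, hy, hz]))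
  refine ⟨E, fun x => h (K.vertexPoint x) x, fun x => hinj _ _ (vertexPoint_mem_openStar x), ?_⟩
  intro x y hxy d
  obtain ⟨m, hmx, hmy⟩ := exists_joinedIn_of_adj hxy
  change h _ y (c x y d) = h _ x d
  rw [hj _ _ _ hmx, hj _ _ _ hmy]
  exact hc _ _ _ hmx.target_mem hmy.target_mem d

theorem oneSkeleton_adj_of_mem_openStar {p : K.Realization} {x y : V} (hx : p ∈ K.openStar x)
    (hy : p ∈ K.openStar y) (hne : x ≠ y) : K.oneSkeleton.Adj x y :=
  ⟨hne, mem_faces_of_mem_openStar (p := p) (by simp) (by simp [hx, hy])⟩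

/-- Vertices whose open stars meet are equal or adjacent, so the stars over one component of the
graph and those over the rest split the realization into disjoint open sets. -/
theorem connected_oneSkeleton [ConnectedSpace K.Realization] : K.oneSkeleton.Connected := by
  obtain ⟨p₀⟩ : Nonempty K.Realization := inferInstance
  obtain ⟨x₀, -⟩ := K.exists_mem_openStar p₀
  let C (x : V) : Prop := K.oneSkeleton.Reachable x₀ x
  have hC {p : K.Realization} {x y : V} (hx : p ∈ K.openStar x) (hy : p ∈ K.openStar y) (h : C x) :
      C y := by
    by_cases hxy : x = y
    · exact hxy ▸ h
    · exact h.trans (oneSkeleton_adj_of_mem_openStar hx hy hxy).reachable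
  let A : Set K.Realization := ⋃ x ∈ {x | C x}, K.openStar x
  have hA : IsOpen A := isOpen_biUnion fun x _ => K.isOpen_openStar x
  have hA' : Aᶜ = ⋃ x ∈ {x | ¬ C x}, K.openStar x := by
    ext p
    simp only [A, Set.mem_compl_iff, Set.mem_iUnion, Set.mem_ofPred_eq, exists_prop, not_exists,
      not_and]
    constructor
    · intro h
      obtain ⟨x, hx⟩ := K.exists_mem_openStar p
      exact ⟨x, fun hc => h x hc hx, hx⟩
    · rintro ⟨x, hx, hpx⟩ y hy hpy
      exact hx (hC hpy hpx hy)
  have hclopen : IsClopen A :=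
    ⟨⟨hA' ▸ isOpen_biUnion fun x _ => K.isOpen_openStar x⟩, hA⟩
  have huniv : A = Set.univ := hclopen.eq_univ
    ⟨K.vertexPoint x₀, Set.mem_biUnion (show C x₀ from .refl _) (vertexPoint_mem_openStar x₀)⟩
  have hall (x : V) : C x := by
    have : K.vertexPoint x ∈ A := huniv ▸ Set.mem_univ _
    obtain ⟨y, hy, hxy⟩ := Set.mem_iUnion₂.1 this
    exact hC hxy (vertexPoint_mem_openStar x) hy
  have : Nonempty V := ⟨x₀⟩
  exact ⟨fun x y => (hall x).symm.trans (hall y)⟩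

end AbstractSimplicialComplex

/-! ### Pullback complexes and the covering by twin classes -/

namespace AbstractSimplicialComplex

variable {V : Type u} {U : Type v}

open Classical in
/-- The largest complex on `U` for which `π` is a non-degenerate simplicial map to `K`. -/
def pullback (K : AbstractSimplicialComplex V) (π : U → V) : AbstractSimplicialComplex U where
  faces := {s | Set.InjOn π s ∧ s.image π ∈ K.faces}
  isRelLowerSet_faces := by
    rintro s ⟨hinj, hs⟩
    refine ⟨Finset.image_nonempty.1 (K.isRelLowerSet_faces hs).1, fun t hts ht => ⟨?_, ?_⟩⟩
    · exact hinj.mono (Finset.coe_subset.2 hts)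
    · exact (K.isRelLowerSet_faces hs).2 (Finset.image_subset_image hts)
        (Finset.image_nonempty.2 ht)
  singleton_mem p := ⟨by simp, by simpa using K.singleton_mem (π p)⟩

variable {K : AbstractSimplicialComplex V} {π : U → V}

open Classical in
theorem mem_faces_pullback {s : Finset U} :
    s ∈ (K.pullback π).faces ↔ Set.InjOn π s ∧ s.image π ∈ K.faces := Iff.rfl

theorem pullback_oneSkeleton_adj {p q : U} :
    (K.pullback π).oneSkeleton.Adj p q ↔ K.oneSkeleton.Adj (π p) (π q) := by
  classical
  constructor
  · rintro ⟨hne, hinj, hf⟩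
    refine ⟨fun h => hne (hinj (by simp) (by simp) h), ?_⟩
    convert hf using 1
    simp
  · rintro ⟨hne, hf⟩
    refine ⟨fun h => hne (congrArg π h), ?_, ?_⟩
    · intro a ha b hb hab
      simp only [Finset.coe_insert, Finset.coe_singleton, Set.mem_insert_iff,
        Set.mem_singleton_iff] at ha hb
      grind
    · convert hf using 1
      simp

open Classical in
theorem triple_mem_faces_pullback {p q r : U} (hpq : π p ≠ π q) (hqr : π q ≠ π r)
    (hpr : π p ≠ π r) (h : {π p, π q, π r} ∈ K.faces) : {p, q, r} ∈ (K.pullback π).faces := by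
  refine ⟨?_, ?_⟩
  · intro a ha b hb hab
    simp only [Finset.coe_insert, Finset.coe_singleton, Set.mem_insert_iff,
      Set.mem_singleton_iff] at ha hb
    grind
  · convert h using 1
    simp

open Classical in
/-- A graph containing, with two sides of a 2-simplex of `K`, also the third one. -/
def IsTriangleClosed (K : AbstractSimplicialComplex V) (S : SimpleGraph V) : Prop :=
  ∀ a b c, {a, b, c} ∈ K.faces → a ≠ c → S.Adj a b → S.Adj b c → S.Adj a c

/-- Vertices of the same fibre of `π` with the same neighbours. -/
def twinSetoid (S : SimpleGraph U) (π : U → V) : Setoid U where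
  r p p' := π p = π p' ∧ ∀ q, S.Adj p q ↔ S.Adj p' q
  iseqv := ⟨fun _ => ⟨rfl, fun _ => Iff.rfl⟩, fun h => ⟨h.1.symm, fun q => (h.2 q).symm⟩,
    fun h h' => ⟨h.1.trans h'.1, fun q => (h.2 q).trans (h'.2 q)⟩⟩

/-- The graph map `π : S → K` is surjective on neighbourhoods. -/
def IsLocallySurjective (K : AbstractSimplicialComplex V) (π : U → V) (S : SimpleGraph U) : Prop :=
  ∀ p z, K.oneSkeleton.Adj (π p) z → ∃ q, S.Adj p q ∧ π q = z

variable {S : SimpleGraph U}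

theorem adj_map (hS : S ≤ (K.pullback π).oneSkeleton) {p q : U} (h : S.Adj p q) : K.oneSkeleton.Adj (π p) (π q) :=
  pullback_oneSkeleton_adj.1 (hS h)

open Classical in
theorem adj_of_adj_of_adj (hS : S ≤ (K.pullback π).oneSkeleton) (hclosed : (K.pullback π).IsTriangleClosed S) {p q r : U} (hpr : π p ≠ π r) (hpq : S.Adj p q) (hqr : S.Adj q r)
    (h : {π p, π q, π r} ∈ K.faces) : S.Adj p r :=
  hclosed p q r (triple_mem_faces_pullback (adj_map hS hpq).1 (adj_map hS hqr).1 hpr h)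
    (fun e => hpr (congrArg π e)) hpq hqr

/-- Vertices of the same fibre with a common neighbour have the same neighbours. -/
theorem twin_of_common_neighbor (hlink : K.HasConnectedLinks) (hS : S ≤ (K.pullback π).oneSkeleton) (hclosed : (K.pullback π).IsTriangleClosed S) (hloc : K.IsLocallySurjective π S) {p p' q : U} (hπ : π p = π p') (hpq : S.Adj p q)
    (hpq' : S.Adj p' q) : (twinSetoid S π).r p p' := by
  classical
  suffices key : ∀ p p' : U, π p = π p' → S.Adj p q → S.Adj p' q → ∀ r, S.Adj p r → S.Adj p' r from
    ⟨hπ, fun r => ⟨key p p' hπ hpq hpq' r, key p' p hπ.symm hpq' hpq r⟩⟩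
  clear hπ hpq hpq' p p'
  intro p p' hπ hpq hpq'
  -- `C w` says that `p` and `p'` have a common neighbour over `w`. It spreads along the link of `π
  -- p`: if `r` is common and `r'` is a neighbour of `p` over an adjacent link vertex, the triangle
  -- `p, r, r'` gives the edge `r r'`, and then `p', r, r'` gives `p' r'`.
  let C (w : {y // K.oneSkeleton.Adj (π p) y}) : Prop := ∃ r, S.Adj p r ∧ S.Adj p' r ∧ π r = w.1
  have step (w w') (hww' : (K.linkGraph (π p)).Adj w w') (hw : C w) (r' : U) (hr' : S.Adj p r')
      (hπr : π r' = w'.1) : S.Adj p' r' := by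
    obtain ⟨r, hr, hpr, hrw⟩ := hw
    obtain ⟨hne, hface⟩ := hww'
    have hne' : w.1 ≠ w'.1 := fun h => hne (Subtype.ext h)
    have h1 : S.Adj r r' := by
      refine adj_of_adj_of_adj hS hclosed (by rwa [hrw, hπr]) hr.symm hr' ?_
      rw [hrw, hπr, Finset.insert_comm]
      exact hface
    refine adj_of_adj_of_adj hS hclosed ?_ hpr h1 ?_
    · rw [← hπ]
      exact (adj_map hS hr').1
    · rw [← hπ, hrw, hπr]
      exact hface
  have hall (w) : C w := by
    have hstart : C ⟨π q, adj_map hS hpq⟩ := ⟨q, hpq, hpq', rfl⟩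
    generalize (⟨π q, adj_map hS hpq⟩ : {y // K.oneSkeleton.Adj (π p) y}) = w₀ at hstart
    obtain ⟨walk⟩ := (hlink (π p)).2.preconnected w₀ w
    induction walk with
    | nil => exact hstart
    | @cons a b _ h _ ih =>
      refine ih ?_
      obtain ⟨r', hr', hπr⟩ := hloc p b.1 b.2
      exact ⟨r', hr', step _ _ h hstart r' hr' hπr, hπr⟩
  intro r hr
  have := (hlink (π p)).1
  -- `C (π r)` alone might be witnessed by a vertex other than `r`; stepping in from an adjacent
  -- link vertex, which exists because the link is not a point, reaches `r` itself.
  obtain ⟨w, hw⟩ := (hlink (π p)).2.preconnected.exists_adj_of_nontrivial ⟨π r, adj_map hS hr⟩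
  exact step w _ hw.symm (hall w) r hr rfl

/-- The quotient of a pullback of a simply connected complex by the twin relation is a covering
space, hence trivial. -/
theorem eq_pullback_oneSkeleton (hlink : K.HasConnectedLinks) (hS : S ≤ (K.pullback π).oneSkeleton) (hclosed : (K.pullback π).IsTriangleClosed S) (hloc : K.IsLocallySurjective π S) [SimplyConnectedSpace K.Realization] (hconn : S.Connected) :
    S = (K.pullback π).oneSkeleton := by
  classical
  let R := twinSetoid S π
  let Q := Quotient R
  let πQ : Q → V := Quotient.lift π fun _ _ h => h.1
  -- Unique edge lifting for twin classes: `c'` is the class of the neighbours of `c` over `y`. The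
  -- value `c` off the edges covers `y = πQ c`, where transport must be the identity.
  have hτ (y : V) (c : Q) : ∃ c' : Q, (K.oneSkeleton.Adj (πQ c) y → πQ c' = y ∧
      ∀ p q, Quotient.mk R p = c → S.Adj p q → π q = y → Quotient.mk R q = c') ∧
      (¬ K.oneSkeleton.Adj (πQ c) y → c' = c) := by
    by_cases h : K.oneSkeleton.Adj (πQ c) y
    · induction c using Quotient.inductionOn with | _ p =>
      obtain ⟨q, hpq, hq⟩ := hloc p y h
      refine ⟨Quotient.mk R q, fun _ => ⟨hq, fun p' q' hp' hpq' hq' => ?_⟩, fun h' => absurd h h'⟩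
      have h1 : S.Adj p q' := ((Quotient.exact hp').2 q').1 hpq'
      exact Quotient.sound (twin_of_common_neighbor hlink hS hclosed hloc (hq'.trans hq.symm)
        h1.symm hpq.symm)
    · exact ⟨c, fun h' => absurd h' h, fun _ => rfl⟩
  choose τ hτ1 hτ2 using hτ
  have hτadj {p q : U} (h : S.Adj p q) : τ (π q) (Quotient.mk R p) = Quotient.mk R q :=
    ((hτ1 (π q) (Quotient.mk R p) (adj_map hS h)).2 p q rfl h rfl).symm
  have hτrep (y : V) (p : U) (h : K.oneSkeleton.Adj (π p) y) :
      ∃ q, S.Adj p q ∧ π q = y ∧ τ y (Quotient.mk R p) = Quotient.mk R q := by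
    obtain ⟨q, hpq, rfl⟩ := hloc p y h
    exact ⟨q, hpq, rfl, hτadj hpq⟩
  have hτself (c : Q) : τ (πQ c) c = c := hτ2 _ _ (SimpleGraph.irrefl _)
  have hτinv (x y : V) (c : Q) (hc : πQ c = x) (h : K.oneSkeleton.Adj x y) : τ x (τ y c) = c := by
    induction c using Quotient.inductionOn with | _ p =>
    obtain rfl : π p = x := hc
    obtain ⟨q, hpq, rfl, hq⟩ := hτrep y p h
    rw [hq, hτadj hpq.symm]
  have hπτ (x y : V) (c : Q) (hc : πQ c = x) (h : K.oneSkeleton.Adj x y) : πQ (τ y c) = y :=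
    (hτ1 y c (hc ▸ h)).1
  have hequiv (x y : V) : Nonempty ({c // πQ c = x} ≃ {c // πQ c = y}) := by
    obtain ⟨walk⟩ := (connected_oneSkeleton (K := K)).preconnected x y
    induction walk with
    | nil => exact ⟨Equiv.refl _⟩
    | @cons a b _ h _ ih =>
      obtain ⟨e⟩ := ih
      let e₁ : {c : Q // πQ c = a} ≃ {c : Q // πQ c = b} :=
        { toFun := fun c => ⟨τ b c.1, hπτ _ _ _ c.2 h⟩
          invFun := fun c => ⟨τ a c.1, hπτ _ _ _ c.2 h.symm⟩
          left_inv := fun c => Subtype.ext (hτinv _ _ _ c.2 h)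
          right_inv := fun c => Subtype.ext (hτinv _ _ _ c.2 h.symm) }
      exact ⟨e₁.trans e⟩
  obtain ⟨p₀⟩ := hconn.nonempty
  -- The identifications of the fibres with a model fibre are arbitrary; the cocycle below records
  -- how transport along edges looks through them.
  let φ (x : V) : {c // πQ c = x} ≃ {c // πQ c = π p₀} := (hequiv x (π p₀)).some
  let F (c : Q) := φ (πQ c) ⟨c, rfl⟩
  let G (x : V) (d) : Q := ((φ x).symm d).1
  have hG (x d) : πQ (G x d) = x := ((φ x).symm d).2
  have hGF (x : V) (c : Q) (hc : πQ c = x) : G x (F c) = c := by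
    subst hc
    simp [G, F]
  have hFG (x d) : F (G x d) = d := by
    have (c : {c // πQ c = x}) : F c.1 = φ x c := by
      obtain ⟨c, rfl⟩ := c
      rfl
    rw [show F (G x d) = φ x ((φ x).symm d) from this _, Equiv.apply_symm_apply]
  obtain ⟨E, h, hinj, hh⟩ := exists_coboundary (K := K) (fun x y d => F (τ y (G x d)))
    (fun x d => by
      have := hτself (G x d)
      rw [hG] at this
      rw [this, hFG])
    (fun x y z hxyz d => by
      have hadj {a b : V} (ha : a ∈ ({x, y, z} : Finset V)) (hb : b ∈ ({x, y, z} : Finset V))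
          (hab : a ≠ b) : K.oneSkeleton.Adj a b :=
        ⟨hab, (K.isRelLowerSet_faces hxyz).2 (by
          intro w hw
          simp only [Finset.mem_insert, Finset.mem_singleton] at hw
          rcases hw with rfl | rfl <;> assumption) (by simp)⟩
      have hGx := hG x d
      generalize G x d = c at hGx
      by_cases hxy : x = y
      · subst hxy
        have := hτself c
        rw [hGx] at this
        rw [this, hGF _ _ hGx]
      have axy : K.oneSkeleton.Adj x y := hadj (by simp) (by simp) hxy
      rw [hGF _ _ (hπτ _ _ _ hGx axy)]
      congr 1
      by_cases hyz : y = z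
      · subst hyz
        have := hτself (τ y c)
        rwa [hπτ _ _ _ hGx axy] at this
      have ayz : K.oneSkeleton.Adj y z := hadj (by simp) (by simp) hyz
      by_cases hxz : x = z
      · subst hxz
        have := hτself c
        rw [hGx] at this
        rw [hτinv _ _ _ hGx axy, this]
      induction c using Quotient.inductionOn with | _ p =>
      obtain rfl : π p = x := hGx
      obtain ⟨q, hpq, rfl, hq⟩ := hτrep y p axy
      obtain ⟨r, hqr, rfl, hr⟩ := hτrep z q ayz
      rw [hq, hr, hτadj (adj_of_adj_of_adj hS hclosed hxz hpq hqr hxyz)])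
  -- Trivializing the cocycle labels each class by an element of `E`, preserved along edges of `S`
  -- and injective on each fibre. Connectedness of `S` forces a single label, hence a single class
  -- per fibre.
  have hconst (p q : U) : h (π p) (F (Quotient.mk R p)) = h (π q) (F (Quotient.mk R q)) := by
    obtain ⟨walk⟩ := hconn.preconnected p q
    induction walk with
    | nil => rfl
    | @cons a b _ hab _ ih =>
      rw [← ih, ← hh _ _ (adj_map hS hab), hGF (π a) (Quotient.mk R a) rfl, hτadj hab]
  refine le_antisymm hS fun p q hpq => ?_
  obtain ⟨q', hpq', hq'⟩ := hloc p (π q) (pullback_oneSkeleton_adj.1 hpq)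
  have h1 := hconst q' q
  rw [hq'] at h1
  have h2 : Quotient.mk R q' = Quotient.mk R q := by
    rw [← hGF (π q) (Quotient.mk R q') hq', hinj _ h1, hGF (π q) (Quotient.mk R q) rfl]
  exact (((Quotient.exact h2).2 p).1 hpq'.symm).symm

end AbstractSimplicialComplex

/-! ### Injective ranks and trees of parents -/

/-- A strictly monotone function to `ℕ` can be made injective on a countable type if the relation
has finitely many predecessors everywhere. -/
theorem exists_injective_rank {I : Type*} [Countable I] (R : I → I → Prop) (ρ : I → ℕ)
    (hρ : ∀ i j, R i j → ρ i < ρ j) (hfin : ∀ j, {i | R i j}.Finite) :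
    ∃ g : I → ℕ, Function.Injective g ∧ ∀ i j, R i j → g i < g j := by
  classical
  obtain ⟨e, he⟩ := exists_injective_nat I
  -- The first entry of the pair gives injectivity; the second bounds the values at all
  -- predecessors, and the `+ 1` makes the inequality strict.
  let step (j : I) (f : ∀ i, ρ i < ρ j → ℕ) : ℕ :=
    Nat.pair (e j) ((hfin j).toFinset.sup fun i => if h : ρ i < ρ j then f i h else 0) + 1
  let g : I → ℕ := (measure ρ).wf.fix step
  have hg (j : I) : g j = Nat.pair (e j) ((hfin j).toFinset.sup
      fun i => if ρ i < ρ j then g i else 0) + 1 := by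
    refine ((measure ρ).wf.fix_eq step j).trans ?_
    simp only [step, dite_eq_ite]
    rfl
  refine ⟨g, fun i j hij => ?_, fun i j hij => ?_⟩
  · rw [hg i, hg j] at hij
    exact he (Nat.pair_eq_pair.1 (Nat.succ_injective hij)).1
  · rw [hg j]
    refine Nat.lt_succ_of_le (le_trans ?_ (Nat.right_le_pair _ _))
    have := Finset.le_sup (f := fun i => if ρ i < ρ j then g i else 0)
      ((hfin j).mem_toFinset.2 hij)
    simpa [hρ i j hij] using this

/-- The graph joining every vertex other than the root to its parent is a tree if passing to the
parent decreases a well-founded rank. -/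
theorem isTree_fromRel_parent {U : Type*} {α : Type*} [LinearOrder α] [WellFoundedLT α] (r : U)
    (par : U → U) (rank : U → α) (h : ∀ p, p ≠ r → rank (par p) < rank p) :
    (SimpleGraph.fromRel fun p q => p ≠ r ∧ par p = q).IsTree := by
  let Rel (p q : U) : Prop := p ≠ r ∧ par p = q
  have hne (p : U) (hp : p ≠ r) : p ≠ par p := fun e => (h p hp).ne (congrArg rank e.symm)
  constructor
  · have hreach (p : U) : (SimpleGraph.fromRel Rel).Reachable p r := by
      induction hn : rank p using WellFoundedLT.induction generalizing p with
      | ind n ih =>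
        by_cases hp : p = r
        · exact hp ▸ .refl _
        · subst hn
          have hadj : (SimpleGraph.fromRel Rel).Adj p (par p) := ⟨hne p hp, Or.inl ⟨hp, rfl⟩⟩
          exact hadj.reachable.trans (ih _ (h p hp) _ rfl)
    have : Nonempty U := ⟨r⟩
    exact ⟨fun p q => (hreach p).trans (hreach q).symm⟩
  · rw [SimpleGraph.isAcyclic_iff_forall_adj_isBridge]
    have hmono {a b : U} (hab : Relation.ReflTransGen Rel a b) : rank b ≤ rank a := by
      induction hab with
      | refl => exact le_rfl
      | tail _ hbc ih => exact (hbc.2 ▸ (h _ hbc.1).le).trans ih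
    -- Among the edges, only the one from `p` to `par p` leaves the set of descendants of `p`. A
    -- walk avoiding it would make `par p` a descendant of `p`, against the decrease of rank.
    have key (p : U) (hp : p ≠ r) : (SimpleGraph.fromRel Rel).IsBridge s(p, par p) := by
      rw [SimpleGraph.isBridge_iff]
      rintro ⟨walk⟩
      have hstep {a b : U} (hab : Rel a b) (hpar : s(a, b) ≠ s(p, par p)) :
          Relation.ReflTransGen Rel a p ↔ Relation.ReflTransGen Rel b p := by
        refine ⟨fun hap => ?_, fun hbp => .head hab hbp⟩
        rcases hap.cases_head with rfl | ⟨c, hac, hcp⟩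
        · exact absurd (by rw [hab.2]) hpar
        · rwa [← hab.2, hac.2]
      have hwalk {a b : U} (w : ((SimpleGraph.fromRel Rel).deleteEdges {s(p, par p)}).Walk a b) :
          Relation.ReflTransGen Rel a p ↔ Relation.ReflTransGen Rel b p := by
        induction w with
        | nil => rfl
        | @cons a b _ hab _ ih =>
          rw [← ih]
          rw [SimpleGraph.deleteEdges_adj] at hab
          rcases hab.1.2 with hr | hr
          · exact hstep hr hab.2
          · exact (hstep hr (by rw [Sym2.eq_swap]; exact hab.2)).symm
      exact (hmono ((hwalk walk).1 .refl)).not_gt (h p hp)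
    rintro a b ⟨-, hab | hab⟩
    · rw [← hab.2]
      exact key a hab.1
    · rw [← hab.2, Sym2.eq_swap]
      exact key b hab.1

/-! ### Generating edges by triangles, and geometric simple connectivity -/

namespace AbstractSimplicialComplex

variable {V : Type u} {U : Type v} {K : AbstractSimplicialComplex V} {T : SimpleGraph V}

/-- The edges generated in `n` stages from those of `T` by adding the third side of 2-simplices. -/
def triangleStage (K : AbstractSimplicialComplex V) (T : SimpleGraph V) : ℕ → Set (Sym2 V)
  | 0 => T.edgeSet
  | n + 1 => K.triangleStage T n ∪ {e | ∃ t ∈ K.faces, t.card = 3 ∧ (∀ x ∈ e, x ∈ t) ∧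
      ∀ e' : Sym2 V, ¬ e'.IsDiag → (∀ x ∈ e', x ∈ t) → e' ≠ e → e' ∈ K.triangleStage T n}

theorem triangleStage_mono : Monotone (K.triangleStage T) :=
  monotone_nat_of_le_succ fun _ _ h => Or.inl h

/-- The graph generated by `T` by adding third sides of 2-simplices. -/
def triangleClosure (K : AbstractSimplicialComplex V) (T : SimpleGraph V) : SimpleGraph V :=
  SimpleGraph.fromEdgeSet (⋃ n, K.triangleStage T n)

theorem triangleClosure_adj {a b : V} :
    (K.triangleClosure T).Adj a b ↔ (∃ n, s(a, b) ∈ K.triangleStage T n) ∧ a ≠ b := by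
  simp [triangleClosure]

theorem le_triangleClosure : T ≤ K.triangleClosure T := fun _ _ h =>
  triangleClosure_adj.2 ⟨⟨0, h⟩, h.ne⟩

theorem triangleClosure_le (hT : T ≤ K.oneSkeleton) : K.triangleClosure T ≤ K.oneSkeleton := by
  classical
  intro a b hab
  obtain ⟨⟨n, hn⟩, hne⟩ := triangleClosure_adj.1 hab
  induction n with
  | zero => exact hT hn
  | succ n ih =>
    rcases hn with hn | ⟨t, ht, -, he, -⟩
    · exact ih hn
    · refine ⟨hne, (K.isRelLowerSet_faces ht).2 ?_ (by simp)⟩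
      intro x hx
      exact he x (by simpa using hx)

theorem isTriangleClosed_triangleClosure : K.IsTriangleClosed (K.triangleClosure T) := by
  classical
  intro a b c ht hac hab hbc
  obtain ⟨⟨m, hm⟩, hab⟩ := triangleClosure_adj.1 hab
  obtain ⟨⟨n, hn⟩, hbc⟩ := triangleClosure_adj.1 hbc
  refine triangleClosure_adj.2 ⟨⟨max m n + 1, Or.inr ⟨_, ht, ?_, ?_, ?_⟩⟩, hac⟩
  · exact Finset.card_eq_three.2 ⟨a, b, c, hab, hac, hbc, by congr⟩
  · simp
  · intro e' hdiag hsub hne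
    have hm' := triangleStage_mono (le_max_left m n) hm
    have hn' := triangleStage_mono (le_max_right m n) hn
    induction e' using Sym2.ind with | _ x y =>
    simp only [Sym2.mem_iff, forall_eq_or_imp, forall_eq, Finset.mem_insert,
      Finset.mem_singleton, Sym2.mk_isDiag_iff] at hsub hdiag
    rcases hsub with ⟨rfl | rfl | rfl, rfl | rfl | rfl⟩ <;>
      first
        | exact absurd rfl hdiag
        | exact absurd rfl hne
        | exact absurd Sym2.eq_swap hne
        | exact hm'
        | exact hn'
        | exact Sym2.eq_swap ▸ hm'
        | exact Sym2.eq_swap ▸ hn'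

/-- A complex whose 1-skeleton is generated by a spanning tree is geometrically simply
connected. -/
theorem isGSC_of_triangleClosure_eq (hT : T ≤ K.oneSkeleton) (htree : T.IsTree)
    (hgen : K.triangleClosure T = K.oneSkeleton) : K.IsGSC := by
  classical
  let I := {e : Sym2 V // e ∈ K.oneSkeleton.edgeSet \ T.edgeSet}
  have hex (i : I) : ∃ n, i.1 ∈ K.triangleStage T n := by
    have hmem {e : Sym2 V} (he : e ∈ K.oneSkeleton.edgeSet) : e ∈ (K.triangleClosure T).edgeSet :=
      hgen ▸ he
    have := hmem i.2.1
    rw [triangleClosure, SimpleGraph.edgeSet_fromEdgeSet] at this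
    exact Set.mem_iUnion.1 this.1
  have hnd (i : I) : ¬ i.1.IsDiag := SimpleGraph.not_isDiag_of_mem_edgeSet _ i.2.1
  -- The stage at which an edge first appears; it is positive off the tree, so a 2-simplex producing
  -- the edge is available.
  let ρ (i : I) : ℕ := Nat.find (hex i)
  have hH (j : I) : ∃ t : {t : Finset V // t ∈ K.faces ∧ t.card = 3}, (∀ x ∈ j.1, x ∈ t.1) ∧
      ∀ i : I, i ≠ j → (∀ x ∈ i.1, x ∈ t.1) → ρ i < ρ j := by
    have hspec : j.1 ∈ K.triangleStage T (ρ j) := Nat.find_spec (hex j)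
    have hmin (m : ℕ) (hm : m < ρ j) : j.1 ∉ K.triangleStage T m := Nat.find_min (hex j) hm
    generalize ρ j = n at hspec hmin
    cases n with
    | zero => exact absurd hspec j.2.2
    | succ n =>
      rcases hspec with hspec | ⟨t, ht, hcard, hj, hoth⟩
      · exact absurd hspec (hmin n n.lt_succ_self)
      · refine ⟨⟨t, ht, hcard⟩, hj, fun i hij hi => Nat.lt_succ_of_le ?_⟩
        exact Nat.find_min' (hex i) (hoth i.1 (hnd i) hi fun h => hij (Subtype.ext h))
  choose H hmem hlt using hH
  let R (i j : I) : Prop := i ≠ j ∧ ∀ x ∈ i.1, x ∈ (H j).1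
  have hR (i j : I) (h : R i j) : ρ i < ρ j := hlt j i h.1 h.2
  have hfin (j : I) : {i | R i j}.Finite := by
    refine Set.Finite.of_finite_image (f := Subtype.val) ?_ Subtype.val_injective.injOn
    refine ((H j).1.sym2.finite_toSet).subset ?_
    rintro _ ⟨i, hi, rfl⟩
    exact Finset.mem_sym2_iff.2 hi.2
  obtain ⟨rank, hinj, hrank⟩ : ∃ rank : I → ℕ, (Countable I → Function.Injective rank) ∧
      ∀ i j, R i j → rank i < rank j := by
    -- The stage itself serves as rank when there are uncountably many edges; otherwise it is
    -- refined to an injective rank, since a 2-simplex has finitely many sides.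
    by_cases hc : Countable I
    · obtain ⟨g, hg, hg'⟩ := exists_injective_rank R ρ hR hfin
      exact ⟨g, fun _ => hg, hg'⟩
    · exact ⟨ρ, fun h => absurd h hc, hR⟩
  refine ⟨T, hT, htree, H, rank, fun i j hij => ?_, hinj,
    fun j i => if j = i then 0 else intersectionNumber (H j).1 i.1, fun i => ?_, fun j i hji => ?_,
    fun j i hji => ?_⟩
  -- If two edges shared a 2-simplex, each would be a side of the one assigned to the other and so
  -- would appear strictly earlier.
  · by_contra hne
    exact lt_asymm (hR i j ⟨hne, hij ▸ hmem i⟩) (hR j i ⟨Ne.symm hne, hij ▸ hmem j⟩)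
  · simp only [if_true, intersectionNumber]
    rw [if_pos (hmem i)]
  · exact (if_neg hji).symm
  · by_cases h : j = i
    · simp [h] at hji
    · refine hrank i j ⟨Ne.symm h, ?_⟩
      by_contra hcon
      simp only [if_neg h, intersectionNumber, if_neg hcon, lt_irrefl] at hji

/-- The pullback of a simply connected complex with connected links is geometrically simply
connected if its 1-skeleton has a spanning tree which is locally surjective over the base. -/
theorem isGSC_pullback {π : U → V} {S : SimpleGraph U} [SimplyConnectedSpace K.Realization]
    (hlink : K.HasConnectedLinks) (htree : S.IsTree) (hS : S ≤ (K.pullback π).oneSkeleton)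
    (hloc : K.IsLocallySurjective π S) : (K.pullback π).IsGSC := by
  refine isGSC_of_triangleClosure_eq hS htree ?_
  refine eq_pullback_oneSkeleton hlink (triangleClosure_le hS) isTriangleClosed_triangleClosure
    (fun p z h => ?_) (htree.connected.mono le_triangleClosure)
  obtain ⟨q, hq, hz⟩ := hloc p z h
  exact ⟨q, le_triangleClosure hq, hz⟩

/-! ### Formal properties of the pullback -/

theorem isNondegenerateMap_pullback {π : U → V} : (K.pullback π).IsNondegenerateMap K π :=
  fun _ hs => ⟨hs.2, hs.1⟩

theorem isInclusion_pullback {W : Type w} {L : AbstractSimplicialComplex W} {π : U → V} {ι : W → U}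
    (hι : Function.Injective ι) (h : L.IsNondegenerateMap K (π ∘ ι)) :
    L.IsInclusion (K.pullback π) ι := by
  classical
  refine ⟨hι, fun s hs => ?_⟩
  obtain ⟨hface, hinj⟩ := h s hs
  refine mem_faces_pullback.2 ⟨?_, ?_⟩
  · rw [Finset.coe_image]
    rintro _ ⟨y, hy, rfl⟩ _ ⟨y', hy', rfl⟩ h
    exact congrArg ι (hinj hy hy' h)
  · rw [Finset.image_image]
    exact hface

/-- A fixed point in the realization is pushed forward by `π` to a point of the realization of `K`
fixed by the same group element, so freeness descends from `K`. -/
theorem isFreeAction_pullback {G : Type w} [Group G] [MulAction G V] [MulAction G U] {π : U → V}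
    (hπ : ∀ (g : G) (p : U), π (g • p) = g • π p) (hG : K.IsFreeAction G) :
    (K.pullback π).IsFreeAction G := by
  classical
  refine ⟨fun g s hs => ?_, fun g p hp => ?_⟩
  · rw [mem_faces_pullback] at hs ⊢
    refine ⟨?_, ?_⟩
    · intro a ha b hb hab
      simp only [Finset.coe_image, Set.mem_image, Finset.mem_coe] at ha hb
      obtain ⟨a, ha, rfl⟩ := ha
      obtain ⟨b, hb, rfl⟩ := hb
      rw [hπ, hπ] at hab
      rw [hs.1 ha hb (MulAction.injective g hab)]
    · have := hG.1 g _ hs.2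
      rw [Finset.image_image] at this ⊢
      convert this using 2
      funext a
      exact hπ g a
  · have hface := mem_faces_pullback.1 p.2.1
    refine hG.2 g ⟨p.1.mapDomain π, ?_, ?_, ?_⟩ ?_
    · rw [Finsupp.mapDomain_support_of_injOn _ hface.1]
      convert hface.2
    · intro x
      rw [Finsupp.mapDomain, Finsupp.sum_apply]
      refine Finset.sum_nonneg fun y _ => ?_
      change 0 ≤ (Finsupp.single (π y) (p.1 y)) x
      rw [Finsupp.single_apply]
      split_ifs
      exacts [p.2.2.1 y, le_rfl]
    · rw [Finsupp.sum_mapDomain_index (fun _ => rfl) (fun _ _ _ => rfl)]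
      exact p.2.2.2
    · change Finsupp.mapDomain (g • ·) (Finsupp.mapDomain π p.1) = Finsupp.mapDomain π p.1
      conv_rhs => rw [← hp]
      rw [← Finsupp.mapDomain_comp, ← Finsupp.mapDomain_comp]
      congr 1
      funext a
      exact (hπ g a).symm

/-! ### The locally surjective tree and the construction of `Z` -/

/-- Over a connected graph, the product of the vertices with the set of words in them carries a
locally surjective tree: the vertex `(x, y :: l)` is attached to `(y, l)` if `x` and `y` are
adjacent. -/
theorem exists_locallySurjective_tree (hconn : K.oneSkeleton.Connected)
    (hnb : ∀ x, ∃ y, K.oneSkeleton.Adj x y) :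
    ∃ S : SimpleGraph (ULift.{v} (V × List V)), S.IsTree ∧ S ≤ (K.pullback (fun p => p.down.1)).oneSkeleton ∧
      K.IsLocallySurjective (fun p => p.down.1) S := by
  classical
  obtain ⟨x₀⟩ := hconn.nonempty
  choose nb hnb using hnb
  have hnear (x : V) : ∃ y, x ≠ x₀ → K.oneSkeleton.Adj x y ∧
      K.oneSkeleton.dist y x₀ < K.oneSkeleton.dist x x₀ := by
    obtain ⟨walk, hwalk⟩ := (hconn.preconnected x x₀).exists_walk_length_eq_dist
    cases walk with
    | nil => exact ⟨x₀, fun h => absurd rfl h⟩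
    | @cons _ y _ h q =>
      refine ⟨y, fun _ => ⟨h, ?_⟩⟩
      rw [← hwalk, SimpleGraph.Walk.length_cons]
      exact Nat.lt_succ_of_le (SimpleGraph.dist_le q)
  choose near hnear using hnear
  -- With the empty word, the parent moves towards `x₀`. Otherwise one letter is removed, and an
  -- arbitrary neighbour `nb x` replaces a first letter not adjacent to `x`, so that parents always
  -- lie over neighbours.
  let par : ULift.{v} (V × List V) → ULift.{v} (V × List V)
    | ⟨(x, [])⟩ => ⟨(near x, [])⟩
    | ⟨(x, y :: l)⟩ => ⟨(if K.oneSkeleton.Adj x y then y else nb x, l)⟩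
  let rank (p : ULift.{v} (V × List V)) : ℕ ×ₗ ℕ :=
    toLex (p.down.2.length, K.oneSkeleton.dist p.down.1 x₀)
  have hpar (p : ULift.{v} (V × List V)) (hp : p ≠ ⟨(x₀, [])⟩) :
      K.oneSkeleton.Adj p.down.1 (par p).down.1 ∧ rank (par p) < rank p := by
    obtain ⟨⟨x, l⟩⟩ := p
    cases l with
    | nil =>
      have := hnear x fun h => hp (by rw [h])
      exact ⟨this.1, Prod.Lex.toLex_lt_toLex.2 (Or.inr ⟨rfl, this.2⟩)⟩
    | cons y l =>
      refine ⟨?_, Prod.Lex.toLex_lt_toLex.2 (Or.inl (by simp [par]))⟩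
      change K.oneSkeleton.Adj x (if K.oneSkeleton.Adj x y then y else nb x)
      split_ifs with h
      exacts [h, hnb x]
  refine ⟨_, isTree_fromRel_parent ⟨(x₀, [])⟩ par rank fun p hp => (hpar p hp).2, ?_, ?_⟩
  · rintro p q ⟨-, ⟨h, rfl⟩ | ⟨h, rfl⟩⟩
    · exact pullback_oneSkeleton_adj.2 (hpar p h).1
    · exact SimpleGraph.Adj.symm
        ((pullback_oneSkeleton_adj (π := fun p : ULift.{v} (V × List V) => p.down.1)).2 (hpar q h).1)
  · rintro ⟨⟨y, l⟩⟩ z hyz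
    -- The child `(z, y :: l)` of `(y, l)` is the required neighbour over `z`.
    refine ⟨⟨(z, y :: l)⟩, ⟨fun h => hyz.ne (congrArg (fun p => p.down.1) h), Or.inr ⟨by simp, ?_⟩⟩, rfl⟩
    change (⟨(if K.oneSkeleton.Adj z y then y else nb z, l)⟩ : ULift.{v} (V × List V)) = ⟨(y, l)⟩
    rw [if_pos hyz.symm]

end AbstractSimplicialComplex

theorem mainTheorem4 {V : Type u} {W : Type v} {G : Type w} [Group G] [MulAction G V]
    (X : AbstractSimplicialComplex V) (Y : AbstractSimplicialComplex W) (F : W → V)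
    (hX : SimplyConnectedSpace X.Realization)
    (hlink : X.HasConnectedLinks)
    (hG : X.IsFreeAction G)
    (hF : Y.IsNondegenerateMap X F)
    (hsurj : Function.Surjective F)
    (hfib : ∀ x : V, (F ⁻¹' {x}).Countable) :
    ∃ (U : Type (max u v w)) (_ : MulAction G U) (Z : AbstractSimplicialComplex U)
      (ι : W → U) (F₁ : U → V),
      Y.IsInclusion Z ι ∧
      (∀ y : W, F₁ (ι y) = F y) ∧
      Z.IsNondegenerateMap X F₁ ∧
      Z.IsGSC ∧
      Z.IsFreeAction G ∧
      ∀ (g : G) (z : U), F₁ (g • z) = g • F₁ z := by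
  classical
  obtain ⟨S, htree, hS, hloc⟩ := AbstractSimplicialComplex.exists_locallySurjective_tree.{u, max v w}
    (AbstractSimplicialComplex.connected_oneSkeleton (K := X))
    fun x => ((hlink x).1.to_nonempty).elim fun y => ⟨y.1, y.2⟩
  have hemb (x : V) : ∃ e : F ⁻¹' {x} → ℕ, Function.Injective e :=
    have := (hfib x).to_subtype
    exists_injective_nat _
  choose e he using hemb
  -- A vertex of `Y` is encoded by its image and by its number in the fibre, written as the length
  -- of a word.
  let ι (y : W) : ULift.{max v w} (V × List V) :=
    ⟨(F y, List.replicate (e (F y) ⟨y, rfl⟩) (F y))⟩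
  have hι : Function.Injective ι := by
    intro y y' h
    have hF' : F y = F y' := congrArg (fun p => p.down.1) h
    have hlen : e (F y) ⟨y, rfl⟩ = e (F y') ⟨y', rfl⟩ := by
      simpa [ι] using congrArg (fun p => p.down.2.length) h
    have htransport (x : V) (hx : F y = x) : e (F y) ⟨y, rfl⟩ = e x ⟨y, hx⟩ := by
      subst hx
      rfl
    exact congrArg Subtype.val (he (F y') ((htransport _ hF').symm.trans hlen))
  -- Words are left fixed. The tree need not be invariant, since `Z` depends only on the projection.
  let act : MulAction G (ULift.{max v w} (V × List V)) :=
    { smul := fun g p => ⟨(g • p.down.1, p.down.2)⟩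
      one_smul := fun p => by
        change (⟨((1 : G) • p.down.1, p.down.2)⟩ : ULift.{max v w} (V × List V)) = p
        rw [one_smul]
      mul_smul := fun g h p => by
        change (⟨((g * h) • p.down.1, p.down.2)⟩ : ULift.{max v w} (V × List V)) =
          ⟨(g • h • p.down.1, p.down.2)⟩
        rw [mul_smul] }
  refine ⟨ULift.{max v w} (V × List V), act, X.pullback fun p => p.down.1, ι,
    fun p => p.down.1, AbstractSimplicialComplex.isInclusion_pullback hι hF, fun _ => rfl,
    AbstractSimplicialComplex.isNondegenerateMap_pullback,
    AbstractSimplicialComplex.isGSC_pullback hlink htree hS hloc,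
    AbstractSimplicialComplex.isFreeAction_pullback (fun _ _ => rfl) hG, fun _ _ => rfl⟩
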